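/- **Green bin packing.** Let $G\in[0,1]$ and $\beta>0$. Items with sizes $a_1,a_2,\dots,a_n\in(0,1]$ arrive one at a time and each is irrevocably placed in a bin of capacity $1$: either an already opened bin in which it still fits, or a newly opened one. If $N$ bins have been opened at the end and the $j$-th has final fill level $L_j$, the cost is $N+\sum_{j=1}^{N}\beta\,(L_j-G)^+$, where $x^+=\max\{0,x\}$. For an input $\sigma=(a_1,\dots,a_n)$ let $\mathrm{OPT}(\sigma)$ be the minimum cost of a packing of $\sigma$ (chosen with full knowledge of $\sigma$), and for a deterministic online algorithm $\mathrm{ALG}$ (the bin of each item depends only on that item and the earlier ones) let $\mathrm{ALG}(\sigma)$ be the cost of its packing of $\sigma$. The (asymptotic) competitive ratio of $\mathrm{ALG}$ is $$\mathrm{CR}(\mathrm{ALG})=\lim_{N\to\infty}\ \sup\Big\{\tfrac{\mathrm{ALG}(\sigma)}{\mathrm{OPT}(\sigma)}:\ \mathrm{OPT}(\sigma)\ge N\Big\}\in[1,\infty].$$ **Theorem.** Let $G\in[0,1]$ and $\beta>0$ with $\beta G\le 1$. Then every deterministic online algorithm for green bin packing with parameters $G,\beta$ has competitive ratio at least $$\frac{r+\beta\,(1-rG)^+}{1+\beta\,(1-G)},\qquad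 r=\frac{248}{161}.$$ -/

import Mathlib

namespace GreenBinPacking

noncomputable section

/-- A finite sequence of items is a legal input when every item size lies in `(0, 1]`. -/
def IsInstance (σ : List ℝ) : Prop :=
  ∀ a ∈ σ, 0 < a ∧ a ≤ 1

/-- An assignment of the items of `σ` (by position) to bins, the bins being labelled by
natural numbers. -/
abbrev Assignment (σ : List ℝ) : Type :=
  Fin σ.length → ℕ

/-- The final fill level of bin `j`. -/
def level (σ : List ℝ) (p : Assignment σ) (j : ℕ) : ℝ :=
  ∑ i : Fin σ.length with p i = j, σ.get i

/-- The opened bins are those that receive at least one item. -/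
def openBins (σ : List ℝ) (p : Assignment σ) : Finset ℕ :=
  Finset.univ.image p

/-- An assignment is a (feasible) packing when no bin is filled beyond its capacity `1`. -/
def IsPacking (σ : List ℝ) (p : Assignment σ) : Prop :=
  ∀ j, level σ p j ≤ 1

/-- The cost of an assignment: `1` for each opened bin, and `β` for each unit of black space
(the part of the fill level above `G`) used in it. -/
def cost (G β : ℝ) (σ : List ℝ) (p : Assignment σ) : ℝ :=
  ((openBins σ p).card : ℝ) + ∑ j ∈ openBins σ p, β * max 0 (level σ p j - G)

/-- The offline optimum: the least cost of a packing of `σ`. -/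
def opt (G β : ℝ) (σ : List ℝ) : ℝ :=
  sInf {c : ℝ | ∃ p : Assignment σ, IsPacking σ p ∧ c = cost G β σ p}

/-- The set of which `opt` is the infimum is nonempty (one bin per item is a packing). -/
theorem exists_packing (σ : List ℝ) (hσ : IsInstance σ) :
    ∃ p : Assignment σ, IsPacking σ p := by
  refine ⟨fun i => i.val, fun j => ?_⟩
  unfold level
  by_cases hj : j < σ.length
  · have h : (Finset.univ.filter fun i : Fin σ.length => i.val = j) = {⟨j, hj⟩} := by
      ext i
      simp [Fin.ext_iff]
    rw [h, Finset.sum_singleton]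
    exact (hσ _ (List.get_mem _ _)).2
  · have h : (Finset.univ.filter fun i : Fin σ.length => i.val = j) = ∅ := by
      ext i
      have := i.isLt
      simp only [Finset.mem_filter, Finset.mem_univ, true_and, Finset.notMem_empty, iff_false]
      omega
    rw [h, Finset.sum_empty]
    exact zero_le_one

/-- The set of which `opt` is the infimum is bounded below by `0`. -/
theorem bddBelow_costs (G β : ℝ) (hβ : 0 ≤ β) (σ : List ℝ) :
    BddBelow {c : ℝ | ∃ p : Assignment σ, IsPacking σ p ∧ c = cost G β σ p} := by
  refine ⟨0, ?_⟩
  rintro c ⟨p, -, rfl⟩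
  unfold cost
  have : 0 ≤ ∑ j ∈ openBins σ p, β * max 0 (level σ p j - G) :=
    Finset.sum_nonneg fun j _ => mul_nonneg hβ (le_max_left _ _)
  positivity

/-- The assignment that a placement rule produces on `σ`: item `i` goes to the bin that the rule
chooses from the items before it and its own size. -/
def onlineAssignment (place : List ℝ → ℝ → ℕ) (σ : List ℝ) : Assignment σ :=
  fun i => place (σ.take i) (σ.get i)

/-- A deterministic online algorithm. `place past a` is the label of the bin in which an item of
size `a` is put after the items `past` have arrived in this order (a label not used before means
that a new bin is opened). As the rule is deterministic, `past` also determines the current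
packing. The choice is irrevocable and ignores later items, and on every legal input no bin is
ever overfilled. -/
structure OnlineAlgorithm where
  place : List ℝ → ℝ → ℕ
  feasible : ∀ σ : List ℝ, IsInstance σ → IsPacking σ (onlineAssignment place σ)

/-- The cost of an online algorithm on the input `σ`. -/
def OnlineAlgorithm.cost (A : OnlineAlgorithm) (G β : ℝ) (σ : List ℝ) : ℝ :=
  GreenBinPacking.cost G β σ (onlineAssignment A.place σ)

/-- The asymptotic competitive ratio: the limit, as `N → ∞`, of the supremum of
`ALG(σ) / OPT(σ)` over the inputs `σ` with `OPT(σ) ≥ N`. It may be `+∞`. -/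
def OnlineAlgorithm.competitiveRatio (A : OnlineAlgorithm) (G β : ℝ) : EReal :=
  ⨅ N : ℕ, ⨆ σ : {σ : List ℝ // IsInstance σ ∧ (N : ℝ) ≤ opt G β σ},
    ((A.cost G β σ.1 / opt G β σ.1 : ℝ) : EReal)

end

end GreenBinPacking

namespace GreenBinPacking

open Finset

/-! ### Item types and the weights certifying the lower bound -/

/-! The adversary sends items slightly larger than …, 1/49, 1/7, 1/3, 1/2, smallest first, `n` of
each type, and may stop after any type `d` (phase `d`). Since 1/2 + 1/3 + 1/7 + 1/49 + … = 1, one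
item of each type nearly fills a bin, and offline the items of phase `d` fill `n / groupsPerBin d`
equally loaded bins. Linear programming duality bounds the number of bins the algorithm has opened.
A bin whose largest type index is `D` is open exactly in the phases `e ≤ D`, and the weight of its
items is at most the sum of those `phaseWeight`s (`bin_weight_le`). Summing over bins
(`sum_weight_le`) compares total weight, about 31/12 per group, with phase-weighted bin counts,
whose offline value is about 161/96 per group. So in some phase the bin counts have ratio at least
nearly (31/12)(96/161) = 248/161 (`exists_phase`). Black space is controlled by total size alone
(`le_cost`), and `ratioBound_mul_le` shows that the offline bins' not being quite full only raises
the cost ratio. -/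

/-- The size of an item of type `d`, up to a small additive constant: `1/2`, `1/3`, and then the
powers of `1/7`. -/
noncomputable def baseSize : ℕ → ℝ
  | 0 => 1 / 2
  | 1 => 1 / 3
  | j + 2 => 1 / 7 ^ (j + 1)

/-- The weight of an item of type `d`. -/
noncomputable def weight : ℕ → ℝ
  | 0 => 1
  | 1 => 1
  | j + 2 => 1 / 2 / 7 ^ j

/-- The multiplier of the phase that ends with the items of type `d`. -/
noncomputable def phaseWeight : ℕ → ℝ
  | 0 => 1
  | 1 => 1
  | 2 => 1
  | j + 3 => 3 / 7 ^ (j + 1)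

/-- How many groups, made of one item of each type `≥ d`, are packed in one bin. -/
def groupsPerBin : ℕ → ℕ
  | 0 => 1
  | 1 => 2
  | j + 2 => 6 * 7 ^ j

theorem baseSize_pos : ∀ d, 0 < baseSize d
  | 0 => by norm_num [baseSize]
  | 1 => by norm_num [baseSize]
  | j + 2 => by simp only [baseSize]; positivity

theorem baseSize_le_half : ∀ d, baseSize d ≤ 1 / 2
  | 0 => by norm_num [baseSize]
  | 1 => by norm_num [baseSize]
  | j + 2 => by
    simp only [baseSize]
    have h : (1 : ℝ) ≤ 7 ^ j := one_le_pow₀ (by norm_num)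
    apply one_div_le_one_div_of_le (by norm_num)
    rw [pow_succ]
    linarith

theorem phaseWeight_nonneg : ∀ d, 0 ≤ phaseWeight d
  | 0 => by norm_num [phaseWeight]
  | 1 => by norm_num [phaseWeight]
  | 2 => by norm_num [phaseWeight]
  | j + 3 => by simp only [phaseWeight]; positivity

theorem groupsPerBin_pos : ∀ d, 0 < groupsPerBin d
  | 0 => by norm_num [groupsPerBin]
  | 1 => by norm_num [groupsPerBin]
  | j + 2 => by simp only [groupsPerBin]; positivity

theorem sum_phaseWeight (j : ℕ) :
    ∑ d ∈ range (j + 3), phaseWeight d = 7 / 2 - 1 / 2 / 7 ^ j := by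
  induction j with
  | zero => norm_num [sum_range_succ, phaseWeight]
  | succ j ih =>
    rw [show j + 1 + 3 = (j + 3) + 1 by ring, sum_range_succ, ih]
    simp only [phaseWeight]
    field_simp
    ring

theorem sum_weight (j : ℕ) :
    ∑ d ∈ range (j + 2), weight d = 31 / 12 - 7 / 12 / 7 ^ j := by
  induction j with
  | zero => norm_num [sum_range_succ, weight]
  | succ j ih =>
    rw [show j + 1 + 2 = (j + 2) + 1 by ring, sum_range_succ, ih]
    simp only [weight]
    field_simp
    ring

theorem sum_phaseWeight_div (j : ℕ) :
    ∑ d ∈ range (j + 3), phaseWeight d / groupsPerBin d = 161 / 96 - 1 / 96 / 49 ^ j := by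
  induction j with
  | zero => norm_num [sum_range_succ, phaseWeight, groupsPerBin]
  | succ j ih =>
    rw [show j + 1 + 3 = (j + 3) + 1 by ring, sum_range_succ, ih]
    simp only [phaseWeight, groupsPerBin]
    push_cast
    rw [show (49 : ℝ) = 7 ^ 2 by norm_num, ← pow_mul, ← pow_mul]
    field_simp
    ring

/-- The items of type at least `d` in one group fill at most `1 / groupsPerBin d`, with some room
to spare. -/
theorem sum_baseSize_le (k d : ℕ) (hd : d ≤ k + 2) :
    ∑ e ∈ Ico d (k + 3), baseSize e ≤ 1 / groupsPerBin d - 1 / 6 / 7 ^ (k + 2) := by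
  have key : ∀ k, ∀ j ≤ k + 1, ∑ e ∈ Ico (j + 2) (k + 3), baseSize e =
      1 / 6 / 7 ^ j - 1 / 6 / 7 ^ (k + 1) := by
    intro k j hj
    induction k with
    | zero =>
      interval_cases j
      · norm_num [sum_Ico_succ_top, baseSize]
      · simp
    | succ k ih =>
      rcases hj.eq_or_lt with rfl | hj
      · simp
      · rw [show k + 1 + 3 = (k + 3) + 1 by ring, sum_Ico_succ_top (by omega), ih (by omega)]
        simp only [baseSize]
        field_simp
        ring
  have hk := key k 0 (by omega)
  -- The truncated geometric tail leaves a gap 1/6/7^(k+1); the smaller gap stated suffices to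
  -- absorb all the excesses.
  have hlt : (1 : ℝ) / 6 / 7 ^ (k + 2) ≤ 1 / 6 / 7 ^ (k + 1) := by
    gcongr
    · norm_num
    · omega
  match d, hd with
  | 0, _ =>
    rw [sum_eq_sum_Ico_succ_bot (by omega), sum_eq_sum_Ico_succ_bot (by omega)]
    simp only [baseSize, groupsPerBin] at hk ⊢
    norm_num at hk ⊢
    norm_num at hlt
    linarith
  | 1, _ =>
    rw [sum_eq_sum_Ico_succ_bot (by omega)]
    simp only [baseSize, groupsPerBin] at hk ⊢
    norm_num at hk ⊢
    norm_num at hlt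
    linarith
  | j + 2, hd =>
    rw [key k j (by omega)]
    simp only [groupsPerBin]
    push_cast
    rw [← div_div]
    linarith

/-- Every type from 2 to `D` has size a multiple of 1/7^(D-1) and weight 7/2 times its size, so
these items are described by one integer `y`. The last two clauses make the truncated subtraction in
`D - 1` harmless. -/
theorem exists_counts {ι : Type*} (S : Finset ι) (d : ι → ℕ) (D : ℕ) (hD : ∀ i ∈ S, d i ≤ D) :
    ∃ a b y : ℕ, ∑ i ∈ S, baseSize (d i) = a / 2 + b / 3 + y / 7 ^ (D - 1) ∧
      ∑ i ∈ S, weight (d i) = a + b + 7 / 2 * (y / 7 ^ (D - 1)) ∧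
      (D = 0 → b = 0) ∧ (D ≤ 1 → y = 0) := by
  classical
  induction S using Finset.induction_on with
  | empty => exact ⟨0, 0, 0, by simp⟩
  | insert i S hi ih =>
    obtain ⟨a, b, y, h1, h2, h3, h4⟩ := ih fun i' hi' => hD i' (mem_insert_of_mem hi')
    have hdi := hD i (mem_insert_self i S)
    rw [sum_insert hi, sum_insert hi, h1, h2]
    match hd : d i with
    | 0 =>
      refine ⟨a + 1, b, y, ?_, ?_, h3, h4⟩ <;> simp only [baseSize, weight] <;> push_cast <;> ring
    | 1 =>
      refine ⟨a, b + 1, y, ?_, ?_, by omega, h4⟩ <;> simp only [baseSize, weight] <;>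
        push_cast <;> ring
    | j + 2 =>
      obtain ⟨l, rfl⟩ : ∃ l, D = j + 2 + l := ⟨D - (j + 2), by omega⟩
      rw [show j + 2 + l - 1 = j + 1 + l by omega] at *
      refine ⟨a, b, y + 7 ^ l, ?_, ?_, by omega, by omega⟩ <;> simp only [baseSize, weight] <;>
        push_cast <;> field_simp <;> ring

/-- If a bin contains no item of type above `D`, then the total weight of its items is at most
the total weight of the phases in which it can be open. -/
theorem bin_weight_le {ι : Type*} (S : Finset ι) (d : ι → ℕ) (D : ℕ) (hD : ∀ i ∈ S, d i ≤ D)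
    (hS : ∑ i ∈ S, baseSize (d i) < 1) :
    ∑ i ∈ S, weight (d i) ≤ ∑ e ∈ range (D + 1), phaseWeight e := by
  obtain ⟨a, b, y, h1, h2, h3, h4⟩ := exists_counts S d D hD
  rw [h2]
  rw [h1] at hS
  match D with
  | 0 =>
    obtain rfl := h3 rfl
    obtain rfl := h4 (by omega)
    norm_num [phaseWeight] at hS ⊢
    have : (a : ℝ) < 2 := by linarith
    have : a < 2 := by exact_mod_cast this
    omega
  | 1 =>
    obtain rfl := h4 le_rfl
    norm_num [sum_range_succ, phaseWeight] at hS ⊢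
    have : (a : ℝ) * 3 + b * 2 < 6 := by linarith
    have : a * 3 + b * 2 < 6 := by exact_mod_cast this
    have : a + b ≤ 2 := by omega
    exact_mod_cast this
  | j + 2 =>
    rw [sum_phaseWeight]
    rw [show j + 2 - 1 = j + 1 by omega] at *
    obtain ⟨p, hp⟩ : ∃ p, p = 7 ^ j := ⟨_, rfl⟩
    have hp1 : 1 ≤ p := hp ▸ Nat.one_le_pow _ _ (by norm_num)
    have hpr : (7 : ℝ) ^ j = p := by rw [hp]; push_cast; rfl
    have hp0 : (0 : ℝ) < p := by exact_mod_cast hp1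
    rw [pow_succ, hpr] at hS
    rw [pow_succ, hpr]
    -- Multiplying by 42 · 7^j clears all denominators, so strictness becomes an integer inequality.
    have hlt : (a : ℝ) * 21 * p + b * 14 * p + 6 * y < 42 * p := by
      field_simp at hS
      linarith
    have hlt' : a * 21 * p + b * 14 * p + 6 * y < 42 * p := by exact_mod_cast hlt
    have ha : a ≤ 1 := by
      by_contra h
      have : 2 * 21 * p ≤ a * 21 * p := by gcongr; omega
      omega
    have hb : b ≤ 2 := by
      by_contra h
      have : 3 * 14 * p ≤ b * 14 * p := by gcongr; omega
      omega
    -- Integrality supplies the `+ 1`, which matches the missing tail 1/2/7^j of the phase weights.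
    have hle : 2 * (a + b) * p + y + 1 ≤ 7 * p := by
      interval_cases a <;> interval_cases b <;> omega
    have hle' : 2 * ((a : ℝ) + b) * p + y + 1 ≤ 7 * p := by exact_mod_cast hle
    field_simp
    linarith

/-- The weighted count, over all phases, of the bins opened so far. -/
theorem sum_weight_le {ι : Type*} (I : Finset ι) (d : ι → ℕ) (q : ι → ℕ) (K : ℕ)
    (hK : ∀ i ∈ I, d i < K)
    (hq : ∀ b ∈ I.image q, ∑ i ∈ I with q i = b, baseSize (d i) < 1) :
    ∑ i ∈ I, weight (d i) ≤
      ∑ e ∈ range K, phaseWeight e * ((I.filter fun i => e ≤ d i).image q).card := by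
  classical
  have hcard : ∀ e, (((I.filter fun i => e ≤ d i).image q).card : ℝ) =
      ∑ b ∈ I.image q, if ∃ i ∈ I, q i = b ∧ e ≤ d i then 1 else 0 := by
    intro e
    rw [sum_boole]
    congr 2
    ext b
    simp only [mem_image, mem_filter]
    constructor
    · rintro ⟨i, ⟨hi, he⟩, rfl⟩
      exact ⟨⟨i, hi, rfl⟩, i, hi, rfl, he⟩
    · rintro ⟨-, i, hi, rfl, he⟩
      exact ⟨i, ⟨hi, he⟩, rfl⟩
  simp_rw [hcard, mul_sum]
  rw [sum_comm, ← sum_fiberwise_of_maps_to (fun i hi => mem_image_of_mem q hi)]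
  refine sum_le_sum fun b hb => ?_
  -- The bin is counted in phase `e` when `e` is at most the largest type index `d i` in it.
  obtain ⟨i₀, hi₀, rfl⟩ := mem_image.1 hb
  obtain ⟨i, hi, hmax⟩ := exists_max_image (I.filter fun i => q i = q i₀) d
    ⟨i₀, by simp [hi₀]⟩
  rw [mem_filter] at hi
  refine (bin_weight_le _ d (d i) hmax (hq _ hb)).trans ?_
  calc ∑ e ∈ range (d i + 1), phaseWeight e
      = ∑ e ∈ range (d i + 1),
          phaseWeight e * if ∃ i ∈ I, q i = q i₀ ∧ e ≤ d i then 1 else 0 := by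
        refine sum_congr rfl fun e he => ?_
        rw [if_pos ⟨i, hi.1, hi.2, by simpa [Nat.lt_succ_iff] using he⟩, mul_one]
    _ ≤ _ := by
        refine sum_le_sum_of_subset_of_nonneg ?_ fun e _ _ => ?_
        · exact range_subset_range.2 (hK i hi.1)
        · exact mul_nonneg (phaseWeight_nonneg e) (by split_ifs <;> norm_num)

/-! ### Inputs given by a stream of items -/

/-- The first `m` items of a stream. -/
def streamInput (s : ℕ → ℝ) (m : ℕ) : List ℝ :=
  (List.range m).map s

@[simp]
theorem length_streamInput (s : ℕ → ℝ) (m : ℕ) : (streamInput s m).length = m := by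
  simp [streamInput]

theorem get_streamInput (s : ℕ → ℝ) (m : ℕ) (i : Fin (streamInput s m).length) :
    (streamInput s m).get i = s i := by
  rw [List.get_eq_getElem]
  simp only [streamInput, List.getElem_map, List.getElem_range]

theorem take_streamInput (s : ℕ → ℝ) {i m : ℕ} (h : i ≤ m) :
    (streamInput s m).take i = streamInput s i := by
  simp [streamInput, ← List.map_take, List.take_range, h]

theorem isInstance_streamInput {s : ℕ → ℝ} (hs : ∀ i, 0 < s i ∧ s i ≤ 1) (m : ℕ) :
    IsInstance (streamInput s m) := by
  intro a ha
  obtain ⟨i, -, rfl⟩ := List.mem_map.1 ha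
  exact hs i

theorem level_streamInput (s : ℕ → ℝ) (m : ℕ) (q : ℕ → ℕ) (j : ℕ) :
    level (streamInput s m) (fun i => q i) j = ∑ i ∈ range m with q i = j, s i := by
  unfold level
  refine sum_bij (fun i _ => i.val) ?_ ?_ ?_ ?_
  · intro i hi
    have := i.isLt
    simp only [length_streamInput] at this
    simp only [mem_filter, mem_univ, true_and, mem_range] at hi ⊢
    exact ⟨this, hi⟩
  · intro i _ i' _ h
    exact Fin.ext h
  · intro i hi
    simp only [mem_filter, mem_range] at hi
    exact ⟨⟨i, by simpa using hi.1⟩, by simpa using hi.2, rfl⟩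
  · intro i _
    exact get_streamInput s m i

theorem openBins_streamInput (s : ℕ → ℝ) (m : ℕ) (q : ℕ → ℕ) :
    openBins (streamInput s m) (fun i => q i) = (range m).image q := by
  ext b
  simp only [openBins, mem_image, mem_univ, true_and, mem_range]
  constructor
  · rintro ⟨i, rfl⟩
    exact ⟨i, by simpa using i.isLt, rfl⟩
  · rintro ⟨i, hi, rfl⟩
    exact ⟨⟨i, by simpa using hi⟩, rfl⟩

/-- The bin in which an online algorithm puts the item `i` of a stream. -/
def OnlineAlgorithm.binOf (A : OnlineAlgorithm) (s : ℕ → ℝ) (i : ℕ) : ℕ :=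
  A.place (streamInput s i) (s i)

/-- This is where being online enters: the bin of item `i` does not depend on `m`, so all phases see
prefixes of one assignment. -/
theorem OnlineAlgorithm.onlineAssignment_streamInput (A : OnlineAlgorithm) (s : ℕ → ℝ) (m : ℕ) :
    onlineAssignment A.place (streamInput s m) =
      fun i : Fin (streamInput s m).length => A.binOf s i := by
  funext i
  have hi : (i : ℕ) ≤ m := by simpa using i.isLt.le
  rw [onlineAssignment, get_streamInput, take_streamInput s hi, binOf]

/-! ### Bounds on costs -/

theorem sum_level (σ : List ℝ) (p : Assignment σ) :
    ∑ j ∈ openBins σ p, level σ p j = ∑ i, σ.get i :=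
  sum_fiberwise_of_maps_to (fun _ hi => mem_image_of_mem p hi) _

theorem sum_get_streamInput (s : ℕ → ℝ) (m : ℕ) :
    ∑ i, (streamInput s m).get i = ∑ i ∈ range m, s i := by
  simpa [level] using level_streamInput s m (fun _ => 0) 0

/-- A sum of positive parts is at least the positive part of the sum. -/
theorem le_cost (G : ℝ) {β : ℝ} (hβ : 0 ≤ β) (σ : List ℝ) (p : Assignment σ) :
    (openBins σ p).card + β * max 0 (∑ i, σ.get i - (openBins σ p).card * G) ≤ cost G β σ p := by
  unfold cost
  rw [← mul_sum, ← sum_level σ p]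
  gcongr
  refine max_le (sum_nonneg fun j _ => le_max_left _ _) ?_
  rw [← nsmul_eq_mul, ← sum_const, ← sum_sub_distrib]
  exact sum_le_sum fun j _ => le_max_right _ _

theorem sum_le_opt (G : ℝ) {β : ℝ} (hβ : 0 ≤ β) (σ : List ℝ) (hσ : IsInstance σ) :
    ∑ i, σ.get i ≤ opt G β σ := by
  obtain ⟨p, hp⟩ := exists_packing σ hσ
  refine le_csInf ⟨_, p, hp, rfl⟩ ?_
  rintro c ⟨p, hp, rfl⟩
  refine le_trans ?_ (le_cost G hβ σ p)
  have h : ∑ i, σ.get i ≤ (openBins σ p).card := by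
    rw [← sum_level σ p]
    simpa using sum_le_card_nsmul _ _ 1 fun j _ => hp j
  have := mul_nonneg hβ (le_max_left 0 (∑ i, σ.get i - (openBins σ p).card * G))
  linarith

theorem opt_le (G : ℝ) {β w : ℝ} (hβ : 0 ≤ β) (hw : w ≤ 1) (σ : List ℝ) (p : Assignment σ)
    (hp : ∀ j, level σ p j ≤ w) (M : ℕ) (hM : (openBins σ p).card ≤ M) :
    opt G β σ ≤ M * (1 + β * max 0 (w - G)) := by
  refine (csInf_le (bddBelow_costs G β hβ σ) ⟨p, fun j => (hp j).trans hw, rfl⟩).trans ?_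
  have h0 : 0 ≤ β * max 0 (w - G) := mul_nonneg hβ (le_max_left _ _)
  have hM' : ((openBins σ p).card : ℝ) ≤ M := by exact_mod_cast hM
  have hsum : ∑ j ∈ openBins σ p, β * max 0 (level σ p j - G) ≤
      (openBins σ p).card * (β * max 0 (w - G)) := by
    rw [← nsmul_eq_mul]
    refine sum_le_card_nsmul _ _ _ fun j _ => ?_
    gcongr
    exact hp j
  unfold cost
  nlinarith

/-- The cost of `r` bins per unit of total size, as a function of `r`. -/
noncomputable def ratioBound (G β r : ℝ) : ℝ :=
  (r + β * max 0 (1 - r * G)) / (1 + β * (1 - G))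

/-- Filling the bins of the optimal packing less does not help the algorithm. -/
theorem ratioBound_mul_le {G β r w : ℝ} (hG0 : 0 ≤ G) (hG1 : G ≤ 1) (hβ : 0 < β)
    (hβG : β * G ≤ 1) (hr : 1 ≤ r) (hw : w ≤ 1) :
    ratioBound G β r * (1 + β * max 0 (w - G)) ≤ r + β * max 0 (w - r * G) := by
  have hden : 0 < 1 + β * (1 - G) := by nlinarith
  rw [ratioBound, div_mul_eq_mul_div, div_le_iff₀ hden]
  have hGr : G ≤ r * G := by nlinarith
  rcases le_total w G with h | h
  · rw [max_eq_left (by linarith : w - G ≤ 0), max_eq_left (by linarith : w - r * G ≤ 0)]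
    rcases le_total (1 - r * G) 0 with h1 | h1
    · rw [max_eq_left h1]
      have : 0 ≤ r * (β * (1 - G)) := by
        have := sub_nonneg.2 hG1
        positivity
      nlinarith
    · rw [max_eq_right h1]
      nlinarith
  · rw [max_eq_right (by linarith : 0 ≤ w - G)]
    -- Passing from fill 1 to fill `w` subtracts β(1 - w) from the denominator and at most that from
    -- the numerator; as the ratio is at least 1, it cannot drop.
    set f := r + β * max 0 (w - r * G) with hf
    have h1 : r + β * max 0 (1 - r * G) ≤ f + β * (1 - w) := by
      have : max 0 (1 - r * G) ≤ max 0 (w - r * G) + (1 - w) := by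
        refine max_le ?_ ?_
        · linarith [le_max_left 0 (w - r * G)]
        · linarith [le_max_right 0 (w - r * G)]
      nlinarith
    have h2 : 1 + β * (w - G) ≤ f := by
      have := le_max_right 0 (w - r * G)
      nlinarith
    have h3 : 0 ≤ β * (1 - w) := mul_nonneg hβ.le (by linarith)
    have h4 : 0 ≤ 1 + β * (w - G) := by nlinarith
    nlinarith

/-- An extra bin costs 1 and saves at most βG ≤ 1 in black space, so `N` may be lowered to `r * M`,
after which `M` factors out. -/
theorem ratioBound_le_div {G β r w x M N c o : ℝ} (hG0 : 0 ≤ G) (hG1 : G ≤ 1) (hβ : 0 < β)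
    (hβG : β * G ≤ 1) (hr : 1 ≤ r) (hw : w ≤ 1) (hM : 0 ≤ M) (ho : 0 < o) (hx : x = M * w)
    (hN : r * M ≤ N) (hc : N + β * max 0 (x - N * G) ≤ c)
    (hopt : o ≤ M * (1 + β * max 0 (w - G))) :
    ratioBound G β r ≤ c / o := by
  have hpos : 0 ≤ ratioBound G β r := by
    have h0 : 0 ≤ β * max 0 (1 - r * G) := mul_nonneg hβ.le (le_max_left _ _)
    exact div_nonneg (by linarith) (by nlinarith)
  rw [le_div_iff₀ ho]
  refine le_trans ?_ hc
  calc ratioBound G β r * o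
      ≤ ratioBound G β r * (M * (1 + β * max 0 (w - G))) := by gcongr
    _ = M * (ratioBound G β r * (1 + β * max 0 (w - G))) := by ring
    _ ≤ M * (r + β * max 0 (w - r * G)) := by
        gcongr
        exact ratioBound_mul_le hG0 hG1 hβ hβG hr hw
    _ = r * M + β * max 0 (x - r * M * G) := by
        rw [hx, mul_add, mul_left_comm M β, mul_max_of_nonneg _ _ hM]
        ring_nf
    _ ≤ N + β * max 0 (x - N * G) := by
        have h : max 0 (x - r * M * G) ≤ max 0 (x - N * G) + (N - r * M) * G := by
          refine max_le ?_ ?_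
          · have := mul_nonneg (sub_nonneg.2 hN) hG0
            linarith [le_max_left 0 (x - N * G)]
          · linarith [le_max_right 0 (x - N * G)]
        nlinarith [mul_le_mul_of_nonneg_left h hβ.le,
          mul_le_mul_of_nonneg_right hβG (sub_nonneg.2 hN)]

/-! ### The adversarial input -/

/-- The amount by which the items exceed their base sizes. -/
noncomputable def excess (k : ℕ) : ℝ :=
  1 / 6 / 7 ^ (k + 2) / (k + 3)

theorem excess_pos (k : ℕ) : 0 < excess k := by
  unfold excess
  positivity

theorem excess_le (k : ℕ) : excess k ≤ 1 / 2 := by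
  unfold excess
  rw [div_div, div_div]
  apply one_div_le_one_div_of_le (by norm_num)
  have h : (1 : ℝ) ≤ 7 ^ (k + 2) * (k + 3) := by
    have h1 : (1 : ℝ) ≤ 7 ^ (k + 2) := one_le_pow₀ (by norm_num)
    have h2 : (1 : ℝ) ≤ k + 3 := by
      have : (0 : ℝ) ≤ k := k.cast_nonneg
      linarith
    nlinarith
  linarith

/-- The type of the item `i`: the types arrive in decreasing order, `n` items of each type. -/
def itemType (k n i : ℕ) : ℕ :=
  k + 2 - i / n

/-- The items of the adversarial input. -/
noncomputable def item (k n i : ℕ) : ℝ :=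
  baseSize (itemType k n i) + excess k

/-- The total size of one item of each type `≥ d`. -/
noncomputable def groupSize (k d : ℕ) : ℝ :=
  ∑ e ∈ Ico d (k + 3), (baseSize e + excess k)

theorem item_mem (k n i : ℕ) : 0 < item k n i ∧ item k n i ≤ 1 := by
  have h1 := baseSize_pos (itemType k n i)
  have h2 := baseSize_le_half (itemType k n i)
  have h3 := excess_pos k
  have h4 := excess_le k
  constructor <;> unfold item <;> linarith

theorem groupSize_pos {k d : ℕ} (hd : d ≤ k + 2) : 0 < groupSize k d :=
  sum_pos (fun e _ => add_pos (baseSize_pos e) (excess_pos k)) ⟨d, by simp; omega⟩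

theorem groupsPerBin_mul_groupSize_le {k d : ℕ} (hd : d ≤ k + 2) :
    groupsPerBin d * groupSize k d ≤ 1 := by
  have hm : (0 : ℝ) < groupsPerBin d := by exact_mod_cast groupsPerBin_pos d
  rw [mul_comm, ← le_div_iff₀ hm, groupSize, sum_add_distrib, sum_const, Nat.card_Ico,
    nsmul_eq_mul]
  have h1 := sum_baseSize_le k d hd
  have h2 : ((k + 3 - d : ℕ) : ℝ) * excess k ≤ 1 / 6 / 7 ^ (k + 2) := by
    calc ((k + 3 - d : ℕ) : ℝ) * excess k ≤ ((k + 3 : ℕ) : ℝ) * excess k := by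
          have := (excess_pos k).le
          gcongr
          omega
      _ = _ := by
          unfold excess
          push_cast
          field_simp
  linarith

theorem groupsPerBin_dvd {k d : ℕ} (hd : d ≤ k + 2) : groupsPerBin d ∣ 6 * 7 ^ k := by
  match d with
  | 0 => exact one_dvd _
  | 1 => exact Dvd.dvd.mul_right (by norm_num [groupsPerBin]) _
  | j + 2 => exact mul_dvd_mul_left _ (pow_dvd_pow _ (by omega))

theorem sum_range_mul_eq {M : Type*} [AddCommMonoid M] (n l : ℕ) (f : ℕ → ℕ → M) (hn : 0 < n) :
    ∑ i ∈ range (n * l), f (i / n) (i % n) = ∑ t ∈ range l, ∑ r ∈ range n, f t r := by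
  induction l with
  | zero => simp
  | succ l ih =>
    rw [mul_add, mul_one, sum_range_add, ih, sum_range_succ]
    congr 1
    refine sum_congr rfl fun r hr => ?_
    have hr := mem_range.1 hr
    rw [Nat.mul_add_div hn, Nat.div_eq_of_lt hr, Nat.mul_add_mod, Nat.mod_eq_of_lt hr, add_zero]

theorem sum_range_type {k d : ℕ} (hd : d ≤ k + 3) (f : ℕ → ℝ) :
    ∑ t ∈ range (k + 3 - d), f (k + 2 - t) = ∑ e ∈ Ico d (k + 3), f e := by
  rw [← Nat.Ico_zero_eq_range, sum_Ico_reflect f 0 (by omega : k + 3 - d ≤ k + 2 + 1)]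
  congr 2
  omega

theorem sum_item {k d n : ℕ} (hd : d ≤ k + 2) (hn : 0 < n) :
    ∑ i ∈ range (n * (k + 3 - d)), item k n i = n * groupSize k d := by
  have h := sum_range_mul_eq n (k + 3 - d) (fun t _ => baseSize (k + 2 - t) + excess k) hn
  simp only [sum_const, card_range, nsmul_eq_mul] at h
  rw [← mul_sum, sum_range_type (by omega) fun e => baseSize e + excess k] at h
  exact h

theorem sum_weight_itemType {k n : ℕ} (hn : 0 < n) :
    ∑ i ∈ range (n * (k + 3)), weight (itemType k n i) =
      n * (31 / 12 - 7 / 12 / 7 ^ (k + 1)) := by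
  have h := sum_range_mul_eq n (k + 3) (fun t _ => weight (k + 2 - t)) hn
  simp only [sum_const, card_range, nsmul_eq_mul] at h
  have h0 := sum_range_type (k := k) (d := 0) (by omega) weight
  rw [Nat.sub_zero, Nat.Ico_zero_eq_range, sum_weight (k + 1)] at h0
  rw [← mul_sum, h0] at h
  exact h

/-- Packing `groupsPerBin d` groups in each bin. -/
theorem opt_item_le (G : ℝ) {β : ℝ} (hβ : 0 ≤ β) {k d n : ℕ} (hd : d ≤ k + 2) (hn : 0 < n)
    (hdvd : groupsPerBin d ∣ n) :
    opt G β (streamInput (item k n) (n * (k + 3 - d))) ≤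
      (n / groupsPerBin d : ℕ) * (1 + β * max 0 (groupsPerBin d * groupSize k d - G)) := by
  set m := groupsPerBin d with hm
  have hm0 : 0 < m := groupsPerBin_pos d
  -- `i % n` is the index of the group of item `i`; each bin takes `m` consecutive groups.
  refine opt_le G hβ (groupsPerBin_mul_groupSize_le hd) _ (fun i => (i : ℕ) % n / m) ?_ _ ?_
  · intro j
    rw [level_streamInput _ _ (fun i => i % n / m), sum_filter]
    have h := sum_range_mul_eq n (k + 3 - d)
      (fun t r => if r / m = j then baseSize (k + 2 - t) + excess k else 0) hn
    refine h.le.trans ?_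
    simp_rw [← sum_filter, sum_const, nsmul_eq_mul]
    rw [← mul_sum, sum_range_type (by omega) fun e => baseSize e + excess k]
    have hpos := (groupSize_pos hd).le
    refine mul_le_mul_of_nonneg_right ?_ hpos
    have hsub : (range n).filter (fun r => r / m = j) ⊆ Ico (m * j) (m * j + m) := by
      intro r hr
      obtain ⟨-, rfl⟩ := mem_filter.1 hr
      have h1 := Nat.div_add_mod r m
      have h2 := Nat.mod_lt r hm0
      rw [mem_Ico]
      omega
    have := card_le_card hsub
    rw [Nat.card_Ico, Nat.add_sub_cancel_left] at this
    exact_mod_cast this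
  · rw [openBins_streamInput _ _ (fun i => i % n / m)]
    have hsub : (range (n * (k + 3 - d))).image (fun i => i % n / m) ⊆ range (n / m) := by
      intro b hb
      obtain ⟨i, -, rfl⟩ := mem_image.1 hb
      exact mem_range.2 (Nat.div_lt_div_of_lt_of_dvd hdvd (Nat.mod_lt i hn))
    simpa using card_le_card hsub

/-! ### Averaging over phases and the limit of the bounds -/

/-- The guaranteed ratio of the numbers of bins, for the input with `k + 3` types. -/
noncomputable def binRatio (k : ℕ) : ℝ :=
  (31 / 12 - 7 / 12 / 7 ^ (k + 1)) * (96 / 161)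

theorem one_le_binRatio (k : ℕ) : 1 ≤ binRatio k := by
  have h : (7 : ℝ) / 12 / 7 ^ (k + 1) ≤ 7 / 12 / 1 := by
    gcongr
    exact one_le_pow₀ (by norm_num)
  unfold binRatio
  linarith

theorem tendsto_binRatio : Filter.Tendsto binRatio Filter.atTop (nhds (248 / 161)) := by
  have h1 : Filter.Tendsto (fun k : ℕ => (1 / 7 : ℝ) ^ (k + 1)) Filter.atTop (nhds 0) :=
    (Filter.tendsto_add_atTop_iff_nat 1).2
      (tendsto_pow_atTop_nhds_zero_of_lt_one (by norm_num) (by norm_num))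
  have h2 := ((h1.const_mul (7 / 12)).const_sub (31 / 12)).mul_const (96 / 161 : ℝ)
  norm_num at h2
  refine h2.congr fun k => ?_
  unfold binRatio
  rw [div_eq_mul_inv (7 / 12 : ℝ) (7 ^ (k + 1)), one_div, inv_pow]

/-- In some phase, the algorithm has opened many more bins than necessary. -/
theorem exists_phase (A : OnlineAlgorithm) {k n : ℕ} (hn : 0 < n)
    (hdvd : ∀ d ≤ k + 2, groupsPerBin d ∣ n) :
    ∃ d ≤ k + 2, binRatio k * (n / groupsPerBin d : ℕ) ≤
      ((range (n * (k + 3 - d))).image (A.binOf (item k n))).card := by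
  set q := A.binOf (item k n) with hqdef
  have hmain := sum_weight_le (range (n * (k + 3))) (itemType k n) q (k + 3)
    (fun _ _ => Nat.lt_succ_of_le (Nat.sub_le _ _)) (by
      intro b hb
      have hpack := A.feasible _ (isInstance_streamInput (item_mem k n) (n * (k + 3))) b
      rw [A.onlineAssignment_streamInput, level_streamInput] at hpack
      refine lt_of_lt_of_le (sum_lt_sum_of_nonempty ?_ fun i _ => ?_) hpack
      · obtain ⟨i, hi, rfl⟩ := mem_image.1 hb
        exact ⟨i, mem_filter.2 ⟨hi, rfl⟩⟩
      · exact lt_add_of_pos_right _ (excess_pos k))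
  rw [sum_weight_itemType hn] at hmain
  have hfilter : ∀ d ≤ k + 2, (range (n * (k + 3))).filter (fun i => d ≤ itemType k n i) =
      range (n * (k + 3 - d)) := by
    intro d hd
    ext i
    have hiff : ∀ l, i < n * l ↔ i / n < l := fun l => by
      rw [Nat.div_lt_iff_lt_mul hn, mul_comm]
    rw [mem_filter, mem_range, mem_range, hiff, hiff, itemType]
    generalize i / n = t
    omega
  by_contra! hcon
  have hlt : ∑ e ∈ range (k + 3),
      phaseWeight e * (((range (n * (k + 3))).filter fun i => e ≤ itemType k n i).image q).card ≤
      ∑ e ∈ range (k + 3), phaseWeight e * (binRatio k * (n / groupsPerBin e : ℕ)) := by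
    refine sum_le_sum fun e he => ?_
    have he : e ≤ k + 2 := by simpa [Nat.lt_succ_iff] using he
    rw [hfilter e he]
    exact mul_le_mul_of_nonneg_left (hcon e he).le (phaseWeight_nonneg e)
  have hsum : ∑ e ∈ range (k + 3), phaseWeight e * (binRatio k * (n / groupsPerBin e : ℕ)) =
      binRatio k * n * (161 / 96 - 1 / 96 / 49 ^ k) := by
    rw [← sum_phaseWeight_div, mul_sum]
    refine sum_congr rfl fun e he => ?_
    have he : e ≤ k + 2 := by simpa [Nat.lt_succ_iff] using he
    have hne : (groupsPerBin e : ℝ) ≠ 0 := by exact_mod_cast (groupsPerBin_pos e).ne'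
    rw [Nat.cast_div (hdvd e he) hne]
    ring
  -- `binRatio` is normalised by the limit 161/96; the finite sum falls short of it, and this gap
  -- gives the contradiction.
  have hpos : 0 < binRatio k * n * (1 / 96 / 49 ^ k) := by
    have h1 : 0 < binRatio k := lt_of_lt_of_le one_pos (one_le_binRatio k)
    positivity
  have heq : (n : ℝ) * (31 / 12 - 7 / 12 / 7 ^ (k + 1)) = binRatio k * n * (161 / 96) := by
    unfold binRatio
    ring
  rw [hsum] at hlt
  linarith [mul_sub (binRatio k * n) (161 / 96) (1 / 96 / 49 ^ k)]

theorem ratioBound_binRatio_le (A : OnlineAlgorithm) {G β : ℝ} (hG0 : 0 ≤ G) (hG1 : G ≤ 1)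
    (hβ : 0 < β) (hβG : β * G ≤ 1) (k : ℕ) :
    (ratioBound G β (binRatio k) : EReal) ≤ A.competitiveRatio G β := by
  refine le_iInf fun N => ?_
  -- Every item exceeds `excess k`, so `n ≥ N / excess k` forces the optimum above `N` whichever
  -- phase is selected.
  obtain ⟨c, hc⟩ := exists_nat_ge ((N : ℝ) / excess k)
  set n := 6 * 7 ^ k * (c + 1) with hndef
  have hn : 0 < n := by positivity
  have hdvd : ∀ d ≤ k + 2, groupsPerBin d ∣ n := fun d hd =>
    Dvd.dvd.mul_right (groupsPerBin_dvd hd) _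
  have hcn : c ≤ n := by
    have : 1 * (c + 1) ≤ n := Nat.mul_le_mul_right _ (Nat.succ_le_of_lt (by positivity))
    omega
  obtain ⟨d, hd, hbins⟩ := exists_phase A hn hdvd
  have hinst := isInstance_streamInput (item_mem k n) (n * (k + 3 - d))
  have hlow := sum_le_opt G hβ.le _ hinst
  rw [sum_get_streamInput, sum_item hd hn] at hlow
  have hgroup : excess k ≤ groupSize k d := by
    refine le_trans ?_ (single_le_sum
      (fun e _ => (add_pos (baseSize_pos e) (excess_pos k)).le) (left_mem_Ico.2 (by omega)))
    linarith [baseSize_pos d]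
  have hN : (N : ℝ) ≤ opt G β (streamInput (item k n) (n * (k + 3 - d))) := by
    refine le_trans ?_ hlow
    have hcn' : (c : ℝ) ≤ n := by exact_mod_cast hcn
    have := (div_le_iff₀ (excess_pos k)).1 (hc.trans hcn')
    exact this.trans (by gcongr)
  refine le_iSup_of_le ⟨_, hinst, hN⟩ (EReal.coe_le_coe_iff.2 ?_)
  have hn' : (0 : ℝ) < n := by exact_mod_cast hn
  have hne : (groupsPerBin d : ℝ) ≠ 0 := by exact_mod_cast (groupsPerBin_pos d).ne'
  have hcost := le_cost G hβ.le (streamInput (item k n) (n * (k + 3 - d)))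
    (onlineAssignment A.place _)
  rw [sum_get_streamInput, sum_item hd hn, A.onlineAssignment_streamInput,
    openBins_streamInput] at hcost
  refine ratioBound_le_div (x := n * groupSize k d) hG0 hG1 hβ hβG
    (one_le_binRatio k) (groupsPerBin_mul_groupSize_le hd)
    (Nat.cast_nonneg _) ((mul_pos hn' (groupSize_pos hd)).trans_le hlow) ?_ hbins ?_
    (opt_item_le G hβ.le hd hn (hdvd d hd))
  · rw [Nat.cast_div (hdvd d hd) hne]
    field_simp
  · rw [OnlineAlgorithm.cost, A.onlineAssignment_streamInput]
    exact hcost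

end GreenBinPacking

theorem theorem6p7 (G β : ℝ) (hG0 : 0 ≤ G) (hG1 : G ≤ 1) (hβ : 0 < β) (hβG : β * G ≤ 1)
    (A : GreenBinPacking.OnlineAlgorithm) :
    ((((248 / 161 : ℝ) + β * max 0 (1 - (248 / 161 : ℝ) * G)) / (1 + β * (1 - G)) : ℝ) : EReal) ≤
      A.competitiveRatio G β := by
  -- The bound holds for each fixed `k`; continuity in `r` carries it to the limit of `binRatio`.
  have hcont : Continuous (GreenBinPacking.ratioBound G β) := by
    unfold GreenBinPacking.ratioBound
    fun_prop
  exact le_of_tendsto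
    ((continuous_coe_real_ereal.tendsto _).comp
      ((hcont.tendsto _).comp GreenBinPacking.tendsto_binRatio))
    (Filter.Eventually.of_forall fun k =>
      GreenBinPacking.ratioBound_binRatio_le A hG0 hG1 hβ hβG k)
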